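/- All graphs are finite, simple, connected and have at least one edge; a plane graph is considered up to orientation-preserving homeomorphism of the plane. For a plane graph $H$ let $\mathcal F_H$ be its set of faces (including the unbounded, or outer, face; the other faces are called inner). Two faces are adjacent if they share an edge, and a set $\mathcal P\subseteq\mathcal F_H$ is connected if any two members of $\mathcal P$ are joined by a sequence of members of $\mathcal P$ in which consecutive faces are adjacent. If $H$ is cubic, a patch of $H$ is a proper subset $\mathcal P\subsetneq\mathcal F_H$ such that both $\mathcal P$ and $\mathcal F_H\setminus\mathcal P$ are connected. The skeleton $G(\mathcal P)$ is the subgraph of $H$ formed by the vertices and edges that are incident with at least one face of $\mathcal P$. **Proposition.** Let $G$ be a plane graph all of whose vertices have degree $2$ or $3$, such that all vertices of degree $2$ lie on the boundary of the outer face, and such that, if there is a vertex of degree $2$, the boundary of the outer face (the outer perimeter) is a cycle. Call a plane cubic graph $\widetilde G$ a *cubic extension* of $G$ if $G$ is a plane subgraph of $\widetilde G$, all inner faces of $G$ are also inner faces of $\widetilde G$, and there is a patch $\mathcal P\subsetneq\mathcal F_{\widetilde G}$ with $G=G(\mathcal P)$. Then: 1. $G$ has a cubic extension. 2. If $G$ is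 2-connected and has at least two vertices of degree $2$, then $G$ has a 2-connected cubic extension. 3. If $G$ is bipartite, then $G$ has a bipartite cubic extension. 4. If $G$ is bipartite and 2-connected, then $G$ has a cubic extension that is both bipartite and 2-connected. -/

import Mathlib

universe u

/-- A rotation system on a simple graph: for every vertex `v`, a cyclic ordering of the darts
(directed edges) that start at `v`. -/
structure RotationSystem {V : Type u} (G : SimpleGraph V) where
  /-- The dart that follows a given dart in the cyclic order around its starting vertex. -/
  rot : Equiv.Perm G.Dart
  rot_fst : ∀ d : G.Dart, (rot d).fst = d.fst
  rot_cyclic : ∀ d e : G.Dart, d.fst = e.fst → rot.SameCycle d e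

namespace RotationSystem

variable {V : Type u} {G : SimpleGraph V} (R : RotationSystem G)

/-- Face tracing: walk along `d`, then leave its end vertex by the dart that follows the
reversal of `d` in the cyclic order there. -/
def faceNext : Equiv.Perm G.Dart :=
  (Function.Involutive.toPerm SimpleGraph.Dart.symm SimpleGraph.Dart.symm_involutive).trans R.rot

/-- The faces of the embedded graph: the orbits of darts under face tracing. -/
def Face : Type u := Quotient (Equiv.Perm.SameCycle.setoid R.faceNext)

end RotationSystem

/-- A plane graph: a finite connected simple graph (with at least one edge), embedded in the plane
up to orientation-preserving homeomorphism. The embedding is recorded by the cyclic order of the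
edges around each vertex, which by Euler's formula has to be one of genus `0`, and by the choice of
the unbounded face. -/
structure PlaneGraph (V : Type u) where
  finite : Finite V
  graph : SimpleGraph V
  connected : graph.Connected
  rotation : RotationSystem graph
  euler : Nat.card V + Nat.card rotation.Face = graph.edgeSet.ncard + 2
  /-- The outer (unbounded) face. -/
  outer : rotation.Face

namespace PlaneGraph

variable {V : Type u} (G : PlaneGraph V)

/-- The set `F_G` of all faces. -/
abbrev Face : Type u := G.rotation.Face

/-- The face on whose boundary walk a dart lies. The two faces incident with an edge, which may
coincide, are the faces of its two darts. -/
def faceOf (d : G.graph.Dart) : G.Face :=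
  Quotient.mk (Equiv.Perm.SameCycle.setoid G.rotation.faceNext) d

/-- The darts of the boundary walk of a face. -/
def boundary (f : G.Face) : Set G.graph.Dart := {d | G.faceOf d = f}

/-- The degree of a vertex. -/
noncomputable def deg (v : V) : ℕ := (G.graph.neighborSet v).ncard

/-- All vertices have degree `2` or `3`. -/
def IsSubcubic : Prop := ∀ v, G.deg v = 2 ∨ G.deg v = 3

/-- All vertices have degree `3`. -/
def IsCubic : Prop := ∀ v, G.deg v = 3

/-- The vertex `v` is incident with the face `f`. -/
def IsOnFace (v : V) (f : G.Face) : Prop := ∃ d ∈ G.boundary f, d.fst = v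

/-- The boundary of the face `f` is a cycle of the graph. -/
def BoundaryIsCycle (f : G.Face) : Prop :=
  ∃ (v : V) (c : G.graph.Walk v v), c.IsCycle ∧ {d | d ∈ c.darts} = G.boundary f

/-- Two faces share an edge. -/
def FaceAdj (a b : G.Face) : Prop := ∃ d : G.graph.Dart, G.faceOf d = a ∧ G.faceOf d.symm = b

/-- A collection of faces is connected: any two of its members are joined by a sequence of members
in which consecutive faces share an edge. -/
def FaceConnected (P : Set G.Face) : Prop :=
  ∀ a ∈ P, ∀ b ∈ P, Relation.ReflTransGen (fun x y => x ∈ P ∧ y ∈ P ∧ G.FaceAdj x y) a b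

/-- A patch (of a plane cubic graph): a proper subset of the set of faces which is connected and
has a connected complement. -/
def IsPatch (P : Set G.Face) : Prop :=
  P ≠ Set.univ ∧ G.FaceConnected P ∧ G.FaceConnected Pᶜ

/-- The skeleton of a collection of faces: all vertices and all edges of the graph which are
incident with at least one face of the collection. -/
def skeleton (P : Set G.Face) : G.graph.Subgraph where
  verts := {v | ∃ f ∈ P, G.IsOnFace v f}
  Adj v w := ∃ d : G.graph.Dart, d.fst = v ∧ d.snd = w ∧ (G.faceOf d ∈ P ∨ G.faceOf d.symm ∈ P)
  adj_sub := by
    rintro v w ⟨d, rfl, rfl, -⟩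
    exact d.adj
  edge_vert := by
    rintro v w ⟨d, rfl, rfl, h | h⟩
    · exact ⟨_, h, d, rfl, rfl⟩
    · refine ⟨_, h, G.rotation.faceNext d.symm, ?_, ?_⟩
      · exact Quotient.sound (Equiv.Perm.SameCycle.symm ⟨1, by simp⟩)
      · change (G.rotation.rot d.symm.symm).fst = d.fst
        rw [SimpleGraph.Dart.symm_symm, G.rotation.rot_fst]
  symm := ⟨by
    rintro v w ⟨d, rfl, rfl, h⟩
    exact ⟨d.symm, rfl, rfl, by rwa [SimpleGraph.Dart.symm_symm, or_comm]⟩⟩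

/-- `G` is 2-connected: it has at least three vertices, and it remains connected when any one vertex
is removed. -/
def TwoConnected : Prop :=
  3 ≤ Nat.card V ∧ G.graph.Connected ∧ ∀ v : V, (G.graph.induce {v}ᶜ).Connected

variable {G} {W : Type u} {H : PlaneGraph W}

/-- A copy `ι` of the graph of `G` in the graph of `H` respects the embeddings: around every vertex,
the cyclic order in `G` is the restriction of the cyclic order in `H`. In other words, the
successor in `G` of a dart `d` is the first dart of the copy of `G` that comes after `d` in `H`. -/
def RespectsRotation (ι : SimpleGraph.Copy G.graph H.graph) : Prop :=
  ∀ d : G.graph.Dart, ∃ k : ℕ, 0 < k ∧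
    (H.rotation.rot ^ k) (ι.toHom.mapDart d) = ι.toHom.mapDart (G.rotation.rot d) ∧
    ∀ j : ℕ, 0 < j → j < k →
      (H.rotation.rot ^ j) (ι.toHom.mapDart d) ∉ Set.range ι.toHom.mapDart

/-- All inner (bounded) faces of `G` are inner faces of `H` too. -/
def PreservesInnerFaces (ι : SimpleGraph.Copy G.graph H.graph) : Prop :=
  ∀ f : G.Face, f ≠ G.outer →
    ∃ f' : H.Face, f' ≠ H.outer ∧ ι.toHom.mapDart '' G.boundary f = H.boundary f'

variable (G H)

/-- `H` is a plane cubic graph that contains `G` as a plane subgraph, such that all inner faces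
of `G` are faces of `H` and `G` is the skeleton of some patch of `H`. -/
def IsCubicExtension : Prop :=
  H.IsCubic ∧ ∃ ι : SimpleGraph.Copy G.graph H.graph,
    RespectsRotation ι ∧ PreservesInnerFaces ι ∧
      ∃ P : Set H.Face, H.IsPatch P ∧ H.skeleton P = ι.toSubgraph

end PlaneGraph

/-! ### Darts and faces of a plane graph -/

namespace PlaneGraph

variable {V : Type u} (G : PlaneGraph V)

/-! Suppose that some vertex has degree 2, so that the outer perimeter is a cycle. Draw the mirror
image of the graph in the outer face and join every vertex of degree 2 to its image by an edge, a
spoke. The result is cubic. With s spokes it has 2E + s edges and 2(F - 1) + s faces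
(`ncard_range_doubleLabel`), so Euler's formula persists. The patch consists of the inner faces of
the first copy. It is connected because a face bounded by a cycle does not separate the other faces
(`faceConnected_compl_of_injOn`); its complement is connected because each face between spokes
shares an edge with a mirrored inner face. Swapping the two colours in the mirror image keeps the
graph bipartite. If the graph is 2-connected, two spokes make the double 2-connected, and a
bipartite graph cannot have exactly one vertex of degree 2 with all others of degree 3: counting
edges from both colour classes would give 3a - 1 = 3b.

If all vertices have degree 3, the graph is its own extension, but its outer boundary need not be a
cycle. The patch then omits a single face f that is not a cut vertex of the dual. Such an f never
lies on both sides of an edge: that edge would be a bridge (`isBridge_of_faceOf_eq`), other faces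
would occur at both of its ends (`exists_faceOf_ne_of_loop`), and f would separate them. Hence every
edge still borders the patch. -/

instance finite_dart : Finite G.graph.Dart :=
  have := G.finite
  Finite.of_injective _ SimpleGraph.Dart.toProd_injective

instance finite_face : Finite G.Face := Quotient.finite _

variable {G}

theorem faceOf_eq_iff {a b : G.graph.Dart} :
    G.faceOf a = G.faceOf b ↔ G.rotation.faceNext.SameCycle a b :=
  Quotient.eq (r := Equiv.Perm.SameCycle.setoid G.rotation.faceNext)

theorem exists_faceOf (f : G.Face) : ∃ d, G.faceOf d = f := Quotient.exists_rep f

theorem faceNext_apply (d : G.graph.Dart) : G.rotation.faceNext d = G.rotation.rot d.symm := rfl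

@[simp]
theorem faceOf_faceNext (d : G.graph.Dart) : G.faceOf (G.rotation.faceNext d) = G.faceOf d :=
  faceOf_eq_iff.2 (Equiv.Perm.sameCycle_apply_left.2 (.refl _ _))

@[simp]
theorem faceNext_fst (d : G.graph.Dart) : (G.rotation.faceNext d).fst = d.snd :=
  G.rotation.rot_fst _

theorem rot_eq_faceNext (d : G.graph.Dart) : G.rotation.rot d = G.rotation.faceNext d.symm := by
  rw [faceNext_apply, SimpleGraph.Dart.symm_symm]

theorem faceOf_rot (d : G.graph.Dart) : G.faceOf (G.rotation.rot d) = G.faceOf d.symm := by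
  rw [rot_eq_faceNext, faceOf_faceNext]

/-- A property that is invariant along a permutation is invariant along its cycles. -/
theorem iff_of_sameCycle {α : Type*} [Finite α] {σ : Equiv.Perm α} {p : α → Prop} {x y : α}
    (h : σ.SameCycle x y) (hp : ∀ z, σ.SameCycle x z → (p z ↔ p (σ z))) : p x ↔ p y := by
  obtain ⟨n, rfl⟩ := h.exists_nat_pow_eq
  clear h
  induction n with
  | zero => rfl
  | succ n ih =>
    rw [pow_succ', Equiv.Perm.mul_apply]
    exact ih.trans (hp _ (Equiv.Perm.sameCycle_pow_right.2 (.refl _ _)))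

theorem exists_dart_ne {v : V} (h : 2 ≤ G.deg v) (u : V) :
    ∃ d : G.graph.Dart, d.fst = v ∧ d.snd ≠ u := by
  obtain ⟨w, hw, hne⟩ := Set.exists_ne_of_one_lt_ncard (s := G.graph.neighborSet v) (by
    unfold deg at h; omega) u
  exact ⟨⟨(v, w), hw⟩, rfl, hne⟩

/-- A property of faces that is invariant under adjacency is constant. -/
theorem face_iff_of_invariant {p : G.Face → Prop}
    (hp : ∀ d, p (G.faceOf d) ↔ p (G.faceOf d.symm)) (a b : G.Face) : p a ↔ p b := by
  obtain ⟨d, rfl⟩ := exists_faceOf a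
  obtain ⟨e, rfl⟩ := exists_faceOf b
  -- Turning from one dart to the next around a vertex crosses an edge: the next dart has the face
  -- of the current dart's reversal.
  have key : ∀ d e : G.graph.Dart, d.fst = e.fst → (p (G.faceOf d) ↔ p (G.faceOf e)) := by
    intro d e h
    refine iff_of_sameCycle (p := fun x => p (G.faceOf x)) (G.rotation.rot_cyclic d e h) ?_
    intro z _
    rw [faceOf_rot]
    exact hp z
  have : ∀ v, G.graph.Reachable d.fst v → ∀ e : G.graph.Dart, e.fst = v →
      (p (G.faceOf d) ↔ p (G.faceOf e)) := by
    intro v hv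
    rw [SimpleGraph.reachable_iff_reflTransGen] at hv
    induction hv with
    | refl => intro e h; exact key d e h.symm
    | @tail v w _ hvw ih =>
      intro e h
      exact (ih ⟨(v, w), hvw⟩ rfl).trans ((hp _).trans (key _ _ h.symm))
  exact this _ (G.connected _ _) e rfl

/-! ### Cuts, bridges and the dual -/

/-- The dual of a cut is not a single non-loop edge of the dual, also after identifying faces. -/
theorem faceOf_mem_iff_of_cut (U : Set V) (A : Set G.Face) {d : G.graph.Dart} (hd : d.fst ∈ U)
    (hd' : d.snd ∉ U) (h : ∀ x : G.graph.Dart, x.fst ∈ U → x.snd ∉ U → x ≠ d →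
      (G.faceOf x ∈ A ↔ G.faceOf x.symm ∈ A)) : G.faceOf d ∈ A ↔ G.faceOf d.symm ∈ A := by
  classical
  have := Fintype.ofFinite G.graph.Dart
  -- Rotation permutes the darts at each vertex and carries the face of `x.symm` to `rot x`, so the
  -- differences `a x - a x.symm` over all darts starting in `U` add up to zero. Edges inside `U`
  -- cancel, and of the cut only `d` can contribute.
  let a : G.graph.Dart → ℤ := fun x => if G.faceOf x ∈ A then 1 else 0
  have h1 : ∑ x : G.graph.Dart, (if x.fst ∈ U then a x else 0) =
      ∑ x : G.graph.Dart, (if x.fst ∈ U then a x.symm else 0) := by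
    rw [← Equiv.sum_comp G.rotation.rot]
    simp only [G.rotation.rot_fst, a, faceOf_rot]
  have h2 : ∑ x : G.graph.Dart, (if x.fst ∈ U ∧ x.snd ∈ U then a x else 0) =
      ∑ x : G.graph.Dart, (if x.fst ∈ U ∧ x.snd ∈ U then a x.symm else 0) := by
    rw [← Equiv.sum_comp
      (Function.Involutive.toPerm SimpleGraph.Dart.symm SimpleGraph.Dart.symm_involutive)]
    refine Finset.sum_congr rfl fun x _ => ?_
    simp [and_comm]
  have h3 : ∑ x : G.graph.Dart, (if x.fst ∈ U ∧ x.snd ∉ U then a x - a x.symm else 0) = 0 := by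
    rw [← sub_eq_zero, ← Finset.sum_sub_distrib] at h1 h2
    have h12 := congrArg₂ (· - ·) h1 h2
    simp only [sub_zero] at h12
    rw [← Finset.sum_sub_distrib] at h12
    refine Eq.trans (Finset.sum_congr rfl fun x _ => ?_) h12
    by_cases p : x.fst ∈ U <;> by_cases q : x.snd ∈ U <;> simp [p, q]
  rw [Finset.sum_eq_single d] at h3
  · simp only [hd, hd', not_false_eq_true, and_self, if_true, a] at h3
    by_cases p : G.faceOf d ∈ A <;> by_cases q : G.faceOf d.symm ∈ A <;> simp_all
  · intro x _ hx
    split_ifs with hc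
    · simp only [a, h x hc.1 hc.2 hx, sub_self]
    · rfl
  · simp

/-- An edge of a plane graph which has the same face on both sides is a bridge. -/
theorem isBridge_of_faceOf_eq {d : G.graph.Dart} (h : G.faceOf d = G.faceOf d.symm) :
    G.graph.IsBridge s(d.fst, d.snd) := by
  have := G.finite
  have : Nonempty G.graph.Dart := ⟨d⟩
  by_contra hb
  -- Tree-cotree argument: `T` is a spanning tree avoiding the edge of `d`. The non-tree edges
  -- connect the dual, so F ≤ |E(D)| + 1. The edge of `d` is a non-tree edge but a loop of the dual,
  -- so |E(D)| ≤ E - (V - 1) - 1. This gives F ≤ E - V + 1, against Euler's formula.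
  obtain ⟨T, hT, hT'⟩ :=
    (G.connected.connected_delete_edge_of_not_isBridge hb).exists_isTree_le
  have hTG : T ≤ G.graph := hT.trans (SimpleGraph.deleteEdges_le _)
  let D : SimpleGraph G.Face :=
    { Adj := fun a b => a ≠ b ∧ ∃ x : G.graph.Dart, x.edge ∉ T.edgeSet ∧
        G.faceOf x = a ∧ G.faceOf x.symm = b
      symm := ⟨by
        rintro a b ⟨hab, x, hx, rfl, rfl⟩
        exact ⟨hab.symm, x.symm, by simpa using hx, rfl, by simp⟩⟩
      loopless := ⟨fun a ha => ha.1 rfl⟩ }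
  have hD : D.Connected := by
    have : Nonempty G.Face := ⟨G.outer⟩
    refine ⟨fun a b => ?_⟩
    refine (face_iff_of_invariant (p := fun f => D.Reachable a f) (fun x => ?_) a b).1 (.refl _)
    have hD1 : ∀ x : G.graph.Dart, x.edge ∉ T.edgeSet →
        (D.Reachable a (G.faceOf x) ↔ D.Reachable a (G.faceOf x.symm)) := by
      intro x hx
      by_cases hne : G.faceOf x = G.faceOf x.symm
      · rw [hne]
      · have : D.Adj (G.faceOf x) (G.faceOf x.symm) := ⟨hne, x, hx, rfl, rfl⟩
        exact ⟨fun h => h.trans this.reachable, fun h => h.trans this.symm.reachable⟩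
    by_cases hx : x.edge ∈ T.edgeSet
    · have hbr := SimpleGraph.isAcyclic_iff_forall_adj_isBridge.1 hT'.isAcyclic
        (show T.Adj x.fst x.snd from hx)
      rw [SimpleGraph.isBridge_iff] at hbr
      -- Deleting the tree edge splits `T`. Apart from `x`, only non-tree darts leave the component
      -- of `x.fst`, and these join faces adjacent in `D`.
      refine faceOf_mem_iff_of_cut
        {v | (T.deleteEdges {s(x.fst, x.snd)}).Reachable x.fst v}
        {f | D.Reachable a f} (.refl _) hbr ?_
      intro z hz hz' hzx
      apply hD1
      intro hzT
      by_cases hzx' : z.edge = x.edge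
      · obtain rfl | rfl := (SimpleGraph.dart_edge_eq_iff _ _).1 hzx'
        · exact hzx rfl
        · exact hbr hz
      · refine hz' (hz.trans (SimpleGraph.Adj.reachable ?_))
        rw [SimpleGraph.deleteEdges_adj]
        exact ⟨hzT, hzx'⟩
    · exact hD1 x hx
  have h1 := hD.card_vert_le_card_edgeSet_add_one
  have h2 : D.edgeSet.ncard ≤ ((G.graph.edgeSet \ T.edgeSet) \ {d.edge}).ncard := by
    have : ∀ e ∈ D.edgeSet, ∃ x : G.graph.Dart, x.edge ∉ T.edgeSet ∧ x.edge ≠ d.edge ∧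
        e = s(G.faceOf x, G.faceOf x.symm) := by
      intro e
      induction e with
      | h a b =>
        rintro ⟨hab, x, hx, rfl, rfl⟩
        refine ⟨x, hx, fun hxd => hab ?_, rfl⟩
        obtain rfl | rfl := (SimpleGraph.dart_edge_eq_iff _ _).1 hxd
        · exact h
        · simpa using h.symm
    choose! g hg1 hg2 hg3 using this
    refine Set.ncard_le_ncard_of_injOn (fun e => (g e).edge)
      (fun e he => ⟨⟨(g e).edge_mem, hg1 e he⟩, hg2 e he⟩) ?_
    intro e he e' he' hee
    rw [hg3 e he, hg3 e' he']
    obtain h | h := (SimpleGraph.dart_edge_eq_iff _ _).1 hee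
    · rw [h]
    · rw [h, SimpleGraph.Dart.symm_symm, Sym2.eq_swap]
  have hde : d.edge ∈ G.graph.edgeSet \ T.edgeSet :=
    ⟨d.edge_mem, fun hd => by
      have := SimpleGraph.edgeSet_mono hT hd
      simp [SimpleGraph.edgeSet_deleteEdges, SimpleGraph.Dart.edge] at this⟩
  have h3 := Set.ncard_sdiff_singleton_add_one hde
  have h4 := Set.ncard_sdiff_add_ncard_of_subset (SimpleGraph.edgeSet_mono hTG)
  have h5 := (SimpleGraph.isTree_iff_connected_and_card.1 hT').2
  have h6 := G.euler
  rw [Nat.card_coe_set_eq] at h1 h5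
  have : Nat.card G.Face = Nat.card G.rotation.Face := rfl
  omega

/-- The part of the graph behind a dart with the same face on both sides meets another face. -/
theorem exists_faceOf_ne_of_loop (hdeg : ∀ v, 2 ≤ G.deg v) {f : G.Face} (n : ℕ)
    {d : G.graph.Dart} (hd : G.faceOf d = f) (hd' : G.faceOf d.symm = f)
    (hn : {v | (G.graph.deleteEdges {s(d.fst, d.snd)}).Reachable d.snd v}.ncard = n) :
    ∃ x : G.graph.Dart, (G.graph.deleteEdges {s(d.fst, d.snd)}).Reachable d.snd x.fst ∧
      G.faceOf x ≠ f := by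
  have := G.finite
  induction n using Nat.strong_induction_on generalizing d with
  | _ n ih =>
  by_contra! hall
  -- If only `f` occurred behind `d`, a further edge at `d.snd` would again have `f` on both sides
  -- and be a bridge. The part behind it is strictly smaller, since it lacks `d.snd`.
  obtain ⟨x, hx, hxd⟩ := exists_dart_ne (hdeg d.snd) d.fst
  have hbd := isBridge_of_faceOf_eq (hd.trans hd'.symm)
  rw [SimpleGraph.isBridge_iff] at hbd
  have hadj : (G.graph.deleteEdges {s(d.fst, d.snd)}).Adj x.fst x.snd := by
    rw [SimpleGraph.deleteEdges_adj]
    refine ⟨x.adj, ?_⟩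
    have := d.adj.ne
    simp only [Set.mem_singleton_iff, Sym2.eq_iff, hx, not_or, not_and]
    exact ⟨fun h => (this h.symm).elim, fun _ => hxd⟩
  have hxW : (G.graph.deleteEdges {s(d.fst, d.snd)}).Reachable d.snd x.snd :=
    hx ▸ hadj.reachable
  have hxf := hall x (hx ▸ .refl _)
  have hxf' := hall x.symm hxW
  have hbx := isBridge_of_faceOf_eq (hxf.trans hxf'.symm)
  rw [SimpleGraph.isBridge_iff] at hbx
  have hsub : ∀ v, (G.graph.deleteEdges {s(x.fst, x.snd)}).Reachable x.snd v →
      (G.graph.deleteEdges {s(d.fst, d.snd)}).Reachable d.snd v := by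
    intro v hv
    rw [SimpleGraph.reachable_iff_reflTransGen] at hv
    induction hv with
    | refl => exact hxW
    | @tail v w hv hvw ih' =>
      refine ih'.trans (SimpleGraph.Adj.reachable ?_)
      rw [SimpleGraph.deleteEdges_adj] at hvw ⊢
      refine ⟨hvw.1, fun he => ?_⟩
      rw [← SimpleGraph.reachable_iff_reflTransGen] at hv
      simp only [Set.mem_singleton_iff, Sym2.eq_iff] at he
      obtain ⟨rfl, -⟩ | ⟨rfl, -⟩ := he
      · exact hbd ih'.symm
      · rw [← hx] at hv
        exact hbx hv.symm
  obtain ⟨y, hy, hyf⟩ := ih _ (by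
    rw [← hn]
    refine Set.ncard_lt_ncard ⟨hsub, fun h => ?_⟩
    have := h (show d.snd ∈ _ from .refl _)
    rw [← hx] at this
    exact hbx this.symm) hxf hxf' rfl
  exact hyf (hall y (hsub _ hy))

/-! ### The cubic case: omitting one face -/

/-- There is a face which lies only on one side of each of its edges, and whose removal leaves the
other faces connected. -/
theorem exists_removable_face (hdeg : ∀ v, 2 ≤ G.deg v) :
    ∃ f : G.Face, G.FaceConnected {f}ᶜ ∧ ∀ d, G.faceOf d = f → G.faceOf d.symm ≠ f := by
  have := G.finite
  obtain ⟨d₀, hd₀⟩ := exists_faceOf G.outer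
  have : Nontrivial G.Face := by
    by_contra hs
    rw [not_nontrivial_iff_subsingleton] at hs
    obtain ⟨x, -, hx⟩ := exists_faceOf_ne_of_loop hdeg _ hd₀ (Subsingleton.elim _ _) rfl
    exact hx (Subsingleton.elim _ _)
  let D : SimpleGraph G.Face :=
    { Adj := fun a b => a ≠ b ∧ G.FaceAdj a b
      symm := ⟨by
        rintro a b ⟨hab, x, rfl, rfl⟩
        exact ⟨hab.symm, x.symm, rfl, by simp⟩⟩
      loopless := ⟨fun a ha => ha.1 rfl⟩ }
  have hD : D.Connected := by
    refine ⟨fun a b => ?_⟩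
    refine (face_iff_of_invariant (p := fun f => D.Reachable a f) (fun x => ?_) a b).1 (.refl _)
    by_cases hne : G.faceOf x = G.faceOf x.symm
    · rw [hne]
    · have : D.Adj (G.faceOf x) (G.faceOf x.symm) := ⟨hne, x, rfl, rfl⟩
      exact ⟨fun h => h.trans this.reachable, fun h => h.trans this.symm.reachable⟩
  obtain ⟨f, hf⟩ := hD.exists_connected_induce_compl_singleton_of_finite_nontrivial
  refine ⟨f, fun a ha b hb => ?_, fun d hd hd' => ?_⟩
  · have := hf.preconnected ⟨a, ha⟩ ⟨b, hb⟩
    rw [SimpleGraph.reachable_iff_reflTransGen] at this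
    refine this.lift (fun x : ({f}ᶜ : Set G.Face) => x.1) fun x y hxy => ?_
    exact ⟨x.2, y.2, (show D.Adj x.1 y.1 from hxy).2⟩
  · have hbd := isBridge_of_faceOf_eq (hd.trans hd'.symm)
    rw [SimpleGraph.isBridge_iff] at hbd
    obtain ⟨x, hx, hxf⟩ := exists_faceOf_ne_of_loop hdeg _ hd hd' rfl
    obtain ⟨y, hy, hyf⟩ := exists_faceOf_ne_of_loop hdeg _ (d := d.symm) hd' (by simpa using hd) rfl
    simp only [SimpleGraph.Dart.symm_toProd, Prod.fst_swap, Prod.snd_swap] at hy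
    rw [Sym2.eq_swap] at hy
    set K := G.graph.deleteEdges {s(d.fst, d.snd)} with hK
    -- Darts on faces other than `f` avoid the bridge, so lying on the side of `d.snd` is constant
    -- along such a face and passes to adjacent ones. As the dual without `f` is connected, this
    -- side would also contain `y`, which lies across the bridge.
    have hstep : ∀ z : G.graph.Dart, G.faceOf z ≠ f →
        (K.Reachable d.snd z.fst ↔ K.Reachable d.snd z.snd) := by
      intro z hz
      have : K.Adj z.fst z.snd := by
        rw [hK, SimpleGraph.deleteEdges_adj]
        refine ⟨z.adj, fun he => hz ?_⟩
        obtain rfl | rfl := (SimpleGraph.dart_edge_eq_iff z d).1 he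
        · exact hd
        · exact hd'
      exact ⟨fun h => h.trans this.reachable, fun h => h.trans this.symm.reachable⟩
    have hface : ∀ z w : G.graph.Dart, G.faceOf z = G.faceOf w → G.faceOf z ≠ f →
        (K.Reachable d.snd z.fst ↔ K.Reachable d.snd w.fst) := by
      intro z w hzw hz
      refine iff_of_sameCycle (p := fun w : G.graph.Dart => K.Reachable d.snd w.fst)
        (faceOf_eq_iff.1 hzw) fun t ht => ?_
      rw [faceNext_fst]
      exact hstep t (by rwa [← faceOf_eq_iff.2 ht])
    have hall : ∀ g : ({f}ᶜ : Set G.Face), (D.induce {f}ᶜ).Reachable ⟨G.faceOf x, hxf⟩ g →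
        ∀ z, G.faceOf z = g → K.Reachable d.snd z.fst := by
      intro g hg
      rw [SimpleGraph.reachable_iff_reflTransGen] at hg
      induction hg with
      | refl => intro z hz; exact (hface x z hz.symm hxf).1 hx
      | @tail a b _ hab ih =>
        obtain ⟨-, t, ht, ht'⟩ := hab
        intro z hz
        have h1 := (hstep t (by rw [ht]; exact a.2)).1 (ih t ht)
        exact (hface t.symm z (ht'.trans hz.symm) (by rw [ht']; exact b.2)).1 h1
    have hy' := hall ⟨G.faceOf y, hyf⟩ (hf.preconnected _ _) y rfl
    exact hbd (hy.trans hy'.symm)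

/-- A plane cubic graph is a cubic extension of itself. -/
theorem isCubicExtension_self (hcubic : G.IsCubic) : G.IsCubicExtension G := by
  have hdeg : ∀ v, 2 ≤ G.deg v := fun v => by rw [hcubic v]; omega
  obtain ⟨f, hf, hf'⟩ := exists_removable_face hdeg
  have hid : (SimpleGraph.Copy.id G.graph).toHom.mapDart = id := by ext <;> rfl
  refine ⟨hcubic, .id _, fun d => ⟨1, one_pos, ?_, ?_⟩, fun g hg => ⟨g, hg, ?_⟩, {f}ᶜ,
    ⟨?_, hf, ?_⟩, ?_⟩
  · simp
  · intro j h1 h2; omega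
  · rw [hid, Set.image_id]
  · intro h
    exact (h ▸ Set.mem_univ f : f ∈ ({f}ᶜ : Set G.Face)) rfl
  · rw [compl_compl]
    rintro _ rfl _ rfl
    exact .refl
  · ext v w
    · simp only [skeleton, SimpleGraph.Subgraph.map_verts, SimpleGraph.Subgraph.verts_top]
      constructor
      · intro _; exact ⟨v, trivial, rfl⟩
      · intro _
        obtain ⟨d, rfl, -⟩ := exists_dart_ne (hdeg v) v
        by_cases hd : G.faceOf d = f
        · exact ⟨_, hf' d hd, G.rotation.rot d, faceOf_rot d, G.rotation.rot_fst d⟩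
        · exact ⟨_, hd, d, rfl, rfl⟩
    · constructor
      · rintro ⟨d, rfl, rfl, -⟩
        exact ⟨_, _, d.adj, rfl, rfl⟩
      · rintro ⟨v, w, h, rfl, rfl⟩
        refine ⟨⟨(v, w), h⟩, rfl, rfl, ?_⟩
        by_cases hd : G.faceOf ⟨(v, w), h⟩ = f
        · exact .inr (hf' _ hd)
        · exact .inl hd

end PlaneGraph

/-! ### Permutation cycles with marked elements -/

theorem perm_inv_apply_self {α : Type*} (σ : Equiv.Perm α) (x : α) : σ⁻¹ (σ x) = x :=
  σ.symm_apply_apply x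

theorem perm_apply_inv_self {α : Type*} (σ : Equiv.Perm α) (x : α) : σ (σ⁻¹ x) = x :=
  σ.apply_symm_apply x

open Equiv.Perm in
theorem sameCycle_of_semiconj {α β : Type*} {f : Equiv.Perm α} {g : Equiv.Perm β} {e : α → β}
    [Finite α] (h : ∀ x, g (e x) = e (f x)) {x y : α} (hxy : f.SameCycle x y) :
    g.SameCycle (e x) (e y) := by
  refine (PlaneGraph.iff_of_sameCycle (p := fun z => g.SameCycle (e x) (e z)) hxy
    fun z _ => ?_).1 (.refl _ _)
  rw [← h, sameCycle_apply_right]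

theorem sameCycle_iff_of_semiconj {α β : Type*} {f : Equiv.Perm α} {g : Equiv.Perm β} (e : α ≃ β)
    [Finite α] (h : ∀ x, g (e x) = e (f x)) {x y : α} :
    g.SameCycle (e x) (e y) ↔ f.SameCycle x y := by
  have : Finite β := .of_equiv _ e
  refine ⟨fun hxy => ?_, sameCycle_of_semiconj h⟩
  have := sameCycle_of_semiconj (f := g) (g := f) (e := e.symm) (fun z => by
    rw [Equiv.eq_symm_apply, ← h, Equiv.apply_symm_apply]) hxy
  simpa using this

/-- The last element of `S` that is met on the way to `x` along the cycle of `x`. -/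
noncomputable def lastMarked {α : Type*} (σ : Equiv.Perm α) (S : Set α) (x : α) : α :=
  (σ⁻¹ ^ sInf {n | (σ⁻¹ ^ n) x ∈ S}) x

section lastMarked

variable {α : Type*} {σ : Equiv.Perm α} {S : Set α}

theorem lastMarked_of_mem {x : α} (hx : x ∈ S) : lastMarked σ S x = x := by
  have : sInf {n | (σ⁻¹ ^ n) x ∈ S} = 0 := Nat.sInf_eq_zero.2 (.inl (show x ∈ S from hx))
  rw [lastMarked, this, pow_zero, Equiv.Perm.one_apply]

variable [Finite α]

/-- The backward walk from `σ x` visits `x` after one step, which shifts the infimum by one. The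
mark `s` on the cycle keeps the set nonempty, so the infimum is not the default value 0. -/
theorem lastMarked_apply {s x : α} (hs : s ∈ S) (h : σ.SameCycle s x) (hx : σ x ∉ S) :
    lastMarked σ S (σ x) = lastMarked σ S x := by
  have hadd : ∀ n, (σ⁻¹ ^ (n + 1)) (σ x) = (σ⁻¹ ^ n) x := fun n => by
    rw [pow_succ, Equiv.Perm.mul_apply, perm_inv_apply_self]
  obtain ⟨n, hn⟩ := (Equiv.Perm.sameCycle_inv.2 h.symm).exists_nat_pow_eq
  have hne : {n | (σ⁻¹ ^ n) (σ x) ∈ S}.Nonempty := ⟨n + 1, by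
    rw [Set.mem_ofPred_eq, hadd, hn]; exact hs⟩
  have hpos : 1 ≤ sInf {n | (σ⁻¹ ^ n) (σ x) ∈ S} := by
    by_contra h0
    have h0 : sInf {n | (σ⁻¹ ^ n) (σ x) ∈ S} = 0 := by omega
    have := Nat.sInf_mem hne
    rw [h0] at this
    exact hx this
  rw [lastMarked, ← Nat.sInf_add hpos, hadd, lastMarked]
  simp only [hadd]

theorem marked_induction {p : α → Prop} {s x : α} (hs : s ∈ S) (h : σ.SameCycle s x)
    (h0 : ∀ s ∈ S, p s) (h1 : ∀ x, σ.SameCycle s x → σ x ∉ S → p x → p (σ x)) : p x := by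
  obtain ⟨n, rfl⟩ := h.exists_nat_pow_eq
  clear h
  induction n with
  | zero => exact h0 _ hs
  | succ n ih =>
    rw [pow_succ', Equiv.Perm.mul_apply]
    by_cases hm : σ ((σ ^ n) s) ∈ S
    · exact h0 _ hm
    · exact h1 _ (Equiv.Perm.sameCycle_pow_right.2 (.refl _ _)) hm ih

end lastMarked

/-! ### Rotation and face tracing in the double -/

namespace PlaneGraph

variable {V : Type u} (G : PlaneGraph V) (S : Set G.graph.Dart)

/-- A set of darts of the outer face that start at distinct vertices. A spoke can be attached to
each of these vertices in the outer face, just before the given dart. -/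
structure IsSpokeSet : Prop where
  subset : S ⊆ G.boundary G.outer
  injOn : Set.InjOn (fun d : G.graph.Dart => d.fst) S
  nonempty : S.Nonempty

/-- Two copies of `G`, with the copies of the starting vertices of the darts in `S` joined. -/
def doubleGraph : SimpleGraph (Bool × V) where
  Adj a b := (a.1 = b.1 ∧ G.graph.Adj a.2 b.2) ∨
    (a.1 ≠ b.1 ∧ a.2 = b.2 ∧ ∃ s ∈ S, s.fst = a.2)
  symm := ⟨by
    rintro ⟨i, v⟩ ⟨j, w⟩ (⟨h, h'⟩ | ⟨h, h', h''⟩)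
    · exact .inl ⟨h.symm, h'.symm⟩
    · exact .inr ⟨h.symm, h'.symm, h' ▸ h''⟩⟩
  loopless := ⟨by rintro ⟨i, v⟩ (⟨-, h⟩ | ⟨h, -⟩) <;> simp at h⟩

open Classical in
/-- The involution that exchanges each dart in `S` with the spoke attached just before it. -/
noncomputable def spokeSwap : Equiv.Perm (G.graph.Dart ⊕ S) :=
  Function.Involutive.toPerm
    (Sum.elim (fun e => if h : e ∈ S then .inr ⟨e, h⟩ else .inl e) (fun s => .inl s)) (by
      rintro (e | s)
      · by_cases h : e ∈ S <;> simp [h]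
      · simp)

variable {G S}

theorem spokeSwap_inl_of_mem {e : G.graph.Dart} (h : e ∈ S) :
    G.spokeSwap S (.inl e) = .inr ⟨e, h⟩ :=
  dif_pos h

theorem spokeSwap_inl_of_notMem {e : G.graph.Dart} (h : e ∉ S) :
    G.spokeSwap S (.inl e) = .inl e :=
  dif_neg h

variable (G S)

/-- The rotation of `G` with the spokes inserted. -/
noncomputable def spokeRot : Equiv.Perm (G.graph.Dart ⊕ S) :=
  (Equiv.sumCongr G.rotation.rot (Equiv.refl S)).trans (G.spokeSwap S)

/-- The rotation of the double: one copy carries the rotation of `G`, the other one the reverse. -/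
noncomputable def doubleRot : Equiv.Perm (Bool × (G.graph.Dart ⊕ S)) :=
  Equiv.prodShear (Equiv.refl Bool) fun b => cond b (G.spokeRot S)⁻¹ (G.spokeRot S)

variable {G S}

/-- Reversal of darts in the double. -/
def doubleSymm : Bool × (G.graph.Dart ⊕ S) → Bool × (G.graph.Dart ⊕ S)
  | (b, .inl e) => (b, .inl e.symm)
  | (b, .inr s) => (!b, .inr s)

theorem doubleSymm_involutive : Function.Involutive (doubleSymm (S := S)) := by
  rintro ⟨b, e | s⟩ <;> simp [doubleSymm]

variable (G S)

/-- Face tracing in the double. -/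
noncomputable def doubleNext : Equiv.Perm (Bool × (G.graph.Dart ⊕ S)) :=
  (doubleSymm_involutive.toPerm _).trans (G.doubleRot S)

variable {G S}

theorem spokeRot_inl (e : G.graph.Dart) :
    G.spokeRot S (.inl e) = G.spokeSwap S (.inl (G.rotation.rot e)) := rfl

theorem spokeRot_inr (s : S) : G.spokeRot S (.inr s) = .inl s.1 := rfl

theorem rot_inv_apply (e : G.graph.Dart) :
    G.rotation.rot⁻¹ e = (G.rotation.faceNext.symm e).symm := by
  rw [Equiv.Perm.inv_eq_iff_eq, rot_eq_faceNext, SimpleGraph.Dart.symm_symm,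
    Equiv.apply_symm_apply]

theorem spokeRot_inv_inl_of_mem {e : G.graph.Dart} (h : e ∈ S) :
    (G.spokeRot S)⁻¹ (.inl e) = .inr ⟨e, h⟩ := by
  rw [Equiv.Perm.inv_eq_iff_eq, spokeRot_inr]

theorem spokeRot_inv_inl_of_notMem {e : G.graph.Dart} (h : e ∉ S) :
    (G.spokeRot S)⁻¹ (.inl e) = .inl (G.rotation.faceNext.symm e).symm := by
  rw [Equiv.Perm.inv_eq_iff_eq, spokeRot_inl, ← rot_inv_apply, perm_apply_inv_self,
    spokeSwap_inl_of_notMem h]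

theorem spokeRot_inv_inr (s : S) :
    (G.spokeRot S)⁻¹ (.inr s) = .inl (G.rotation.faceNext.symm s).symm := by
  rw [Equiv.Perm.inv_eq_iff_eq, spokeRot_inl, ← rot_inv_apply, perm_apply_inv_self,
    spokeSwap_inl_of_mem s.2]

/-- These rules trace a face between spokes: along the outer boundary of the first copy from a dart
of `S`, over the next spoke, back along the reversed darts of the mirror image, and over the spoke
at the initial dart. -/
theorem doubleNext_false_inl_of_mem {e : G.graph.Dart} (h : G.rotation.faceNext e ∈ S) :
    G.doubleNext S (false, .inl e) = (false, .inr ⟨_, h⟩) :=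
  congrArg (Prod.mk false) (spokeSwap_inl_of_mem h)

theorem doubleNext_false_inl_of_notMem {e : G.graph.Dart} (h : G.rotation.faceNext e ∉ S) :
    G.doubleNext S (false, .inl e) = (false, .inl (G.rotation.faceNext e)) :=
  congrArg (Prod.mk false) (spokeSwap_inl_of_notMem h)

theorem doubleNext_true_inl_of_mem {e : G.graph.Dart} (h : e.symm ∈ S) :
    G.doubleNext S (true, .inl e) = (true, .inr ⟨_, h⟩) :=
  congrArg (Prod.mk true) (spokeRot_inv_inl_of_mem h)

theorem doubleNext_true_inl_of_notMem {e : G.graph.Dart} (h : e.symm ∉ S) :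
    G.doubleNext S (true, .inl e) = (true, .inl (G.rotation.faceNext.symm e.symm).symm) :=
  congrArg (Prod.mk true) (spokeRot_inv_inl_of_notMem h)

theorem doubleNext_false_inr (s : S) :
    G.doubleNext S (false, .inr s) = (true, .inl (G.rotation.faceNext.symm s).symm) :=
  congrArg (Prod.mk true) (spokeRot_inv_inr s)

theorem doubleNext_true_inr (s : S) : G.doubleNext S (true, .inr s) = (false, .inl s.1) := rfl

variable (S)

open Classical in
/-- The face of the double to which a dart of a copy of `G` belongs: a copy of an inner face, or a
face between two spokes, which is represented by a dart in `S`. -/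
noncomputable def copyLabel (b : Bool) (e : G.graph.Dart) : (Bool × G.Face) ⊕ G.graph.Dart :=
  if G.faceOf e = G.outer then .inr (lastMarked G.rotation.faceNext S e) else .inl (b, G.faceOf e)

/-- The face of the double to which a dart belongs. -/
noncomputable def doubleLabel : Bool × (G.graph.Dart ⊕ S) → (Bool × G.Face) ⊕ G.graph.Dart
  | (false, .inl e) => copyLabel S false e
  | (true, .inl e) => copyLabel S true e.symm
  | (false, .inr s) => copyLabel S false (G.rotation.faceNext.symm s)
  | (true, .inr s) => copyLabel S false s.1

variable {S}

theorem copyLabel_of_outer {e : G.graph.Dart} (h : G.faceOf e = G.outer) (b : Bool) :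
    copyLabel S b e = .inr (lastMarked G.rotation.faceNext S e) := if_pos h

theorem copyLabel_of_inner {e : G.graph.Dart} (h : G.faceOf e ≠ G.outer) (b : Bool) :
    copyLabel S b e = .inl (b, G.faceOf e) := if_neg h

theorem faceOf_faceNext_symm (e : G.graph.Dart) :
    G.faceOf (G.rotation.faceNext.symm e) = G.faceOf e := by
  rw [← faceOf_faceNext, Equiv.apply_symm_apply]

namespace IsSpokeSet

variable (hS : G.IsSpokeSet S)
include hS

theorem exists_sameCycle {e : G.graph.Dart} (h : G.faceOf e = G.outer) :
    ∃ s ∈ S, G.rotation.faceNext.SameCycle s e := by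
  obtain ⟨s, hs⟩ := hS.nonempty
  exact ⟨s, hs, faceOf_eq_iff.1 ((hS.subset hs : G.faceOf s = G.outer).trans h.symm)⟩

theorem copyLabel_faceNext {e : G.graph.Dart} (h : G.rotation.faceNext e ∉ S) (b : Bool) :
    copyLabel S b (G.rotation.faceNext e) = copyLabel S b e := by
  unfold copyLabel
  rw [faceOf_faceNext]
  split_ifs with he
  · obtain ⟨s, hs, hse⟩ := hS.exists_sameCycle he
    rw [lastMarked_apply hs hse h]
  · rfl

theorem copyLabel_of_mem {e : G.graph.Dart} (h : e ∈ S) (b : Bool) :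
    copyLabel S b e = .inr e := by
  rw [copyLabel_of_outer (hS.subset h), lastMarked_of_mem h]

/-- Along the outer boundary the label changes only on entering `S`, and exactly there tracing in
the double turns into a spoke. -/
theorem doubleLabel_doubleNext (x : Bool × (G.graph.Dart ⊕ S)) :
    doubleLabel S (G.doubleNext S x) = doubleLabel S x := by
  rcases x with ⟨_ | _, e | s⟩
  · by_cases h : G.rotation.faceNext e ∈ S
    · rw [doubleNext_false_inl_of_mem h]
      simp [doubleLabel]
    · rw [doubleNext_false_inl_of_notMem h]
      exact hS.copyLabel_faceNext h _
  · rw [doubleNext_false_inr]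
    have h := (faceOf_faceNext_symm s.1).trans (hS.subset s.2)
    simp only [doubleLabel, SimpleGraph.Dart.symm_symm, copyLabel_of_outer h]
  · by_cases h : e.symm ∈ S
    · rw [doubleNext_true_inl_of_mem h]
      simp only [doubleLabel, copyLabel_of_outer (hS.subset h)]
    · rw [doubleNext_true_inl_of_notMem h]
      have := hS.copyLabel_faceNext (e := G.rotation.faceNext.symm e.symm) (by simpa using h) true
      simpa [doubleLabel] using this.symm
  · rfl

/-- The spoke `(true, .inr s)` is the base point of its face: tracing from it follows the boundary
segment after `s` in the first copy, and the reversed segment of the mirror image is traced into it.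
-/
theorem sameCycle_of_outer {e : G.graph.Dart} (h : G.faceOf e = G.outer) :
    ∃ s : S, lastMarked G.rotation.faceNext S e = s ∧
      (G.doubleNext S).SameCycle (true, .inr s) (false, .inl e) ∧
      (G.doubleNext S).SameCycle (true, .inr s) (true, .inl e.symm) := by
  obtain ⟨s, hs, hse⟩ := hS.exists_sameCycle h
  refine marked_induction (p := fun e => ∃ s : S, lastMarked G.rotation.faceNext S e = s ∧
      (G.doubleNext S).SameCycle (true, .inr s) (false, .inl e) ∧
      (G.doubleNext S).SameCycle (true, .inr s) (true, .inl e.symm)) hs hse (fun t ht => ?_) ?_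
  · refine ⟨⟨t, ht⟩, lastMarked_of_mem ht, ?_, ?_⟩
    · rw [← Equiv.Perm.sameCycle_apply_left, doubleNext_true_inr]
    · rw [← Equiv.Perm.sameCycle_apply_right, doubleNext_true_inl_of_mem (by simpa using ht)]
      simp only [SimpleGraph.Dart.symm_symm]
      exact .refl _ _
  · rintro x hx hxS ⟨t, ht, h1, h2⟩
    refine ⟨t, (lastMarked_apply hs hx hxS).trans ht, ?_, ?_⟩
    · rwa [← doubleNext_false_inl_of_notMem hxS, Equiv.Perm.sameCycle_apply_right]
    · rw [← Equiv.Perm.sameCycle_apply_right, doubleNext_true_inl_of_notMem (by simpa using hxS)]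
      simpa using h2

/-- An inner face has no dart in `S`, so no spoke interrupts its tracing; in the mirror image it is
traced backwards through reversed darts. -/
theorem sameCycle_of_inner {e e' : G.graph.Dart} (h : G.faceOf e = G.faceOf e')
    (he : G.faceOf e ≠ G.outer) (b : Bool) :
    (G.doubleNext S).SameCycle (b, .inl (cond b e.symm e)) (b, .inl (cond b e'.symm e')) := by
  refine (iff_of_sameCycle (p := fun z => (G.doubleNext S).SameCycle (b, .inl (cond b e.symm e))
    (b, .inl (cond b z.symm z))) (faceOf_eq_iff.1 h) fun z hz => ?_).1 (.refl _ _)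
  have hzS : G.rotation.faceNext z ∉ S := fun hm => by
    have := hS.subset hm
    rw [boundary, Set.mem_ofPred_eq, faceOf_faceNext, ← faceOf_eq_iff.2 hz] at this
    exact he this
  cases b
  · simp only [cond_false]
    rw [← doubleNext_false_inl_of_notMem hzS, Equiv.Perm.sameCycle_apply_right]
  · simp only [cond_true]
    rw [← Equiv.Perm.sameCycle_apply_right (y := (true, Sum.inl (G.rotation.faceNext z).symm)),
      doubleNext_true_inl_of_notMem (by simpa using hzS)]
    simp

theorem doubleLabel_cases (x : Bool × (G.graph.Dart ⊕ S)) :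
    (∃ s : S, doubleLabel S x = .inr s.1 ∧ (G.doubleNext S).SameCycle (true, .inr s) x) ∨
    ∃ b e, G.faceOf e ≠ G.outer ∧ doubleLabel S x = .inl (b, G.faceOf e) ∧
      x = (b, .inl (cond b e.symm e)) := by
  rcases x with ⟨b, e | s⟩
  · cases b
    · by_cases h : G.faceOf e = G.outer
      · obtain ⟨s, hs, h1, h2⟩ := hS.sameCycle_of_outer h
        exact .inl ⟨s, by rw [doubleLabel, copyLabel_of_outer h, hs], h1⟩
      · exact .inr ⟨false, e, h, copyLabel_of_inner h _, rfl⟩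
    · by_cases h : G.faceOf e.symm = G.outer
      · obtain ⟨s, hs, h1, h2⟩ := hS.sameCycle_of_outer h
        exact .inl ⟨s, by rw [doubleLabel, copyLabel_of_outer h, hs], by simpa using h2⟩
      · exact .inr ⟨true, e.symm, h, copyLabel_of_inner h _, by simp⟩
  · cases b
    · have h := (faceOf_faceNext_symm s.1).trans (hS.subset s.2)
      obtain ⟨t, ht, h1, h2⟩ := hS.sameCycle_of_outer h
      refine .inl ⟨t, by rw [doubleLabel, copyLabel_of_outer h, ht], ?_⟩
      rw [← Equiv.Perm.sameCycle_apply_right, doubleNext_false_inr]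
      exact h2
    · exact .inl ⟨s, hS.copyLabel_of_mem s.2 _, .refl _ _⟩

theorem doubleNext_sameCycle_iff {x y : Bool × (G.graph.Dart ⊕ S)} :
    (G.doubleNext S).SameCycle x y ↔ doubleLabel S x = doubleLabel S y := by
  constructor
  · intro h
    refine (iff_of_sameCycle (p := fun z => doubleLabel S x = doubleLabel S z) h
      fun z _ => ?_).1 rfl
    rw [hS.doubleLabel_doubleNext]
  · intro h
    obtain ⟨s, hs, h1⟩ | ⟨b, e, he, hb, rfl⟩ := hS.doubleLabel_cases x <;>
    obtain ⟨t, ht, h2⟩ | ⟨c, e', he', hc, rfl⟩ := hS.doubleLabel_cases y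
    · rw [hs, ht, Sum.inr.injEq] at h
      rw [Subtype.ext h] at h1
      exact h1.symm.trans h2
    · simp [hs, hc] at h
    · simp [hb, ht] at h
    · rw [hb, hc, Sum.inl.injEq, Prod.mk.injEq] at h
      obtain ⟨rfl, h⟩ := h
      exact hS.sameCycle_of_inner h he b

theorem range_doubleLabel : Set.range (doubleLabel S) =
    Sum.inl '' (Set.univ ×ˢ {G.outer}ᶜ) ∪ Sum.inr '' S := by
  ext l
  constructor
  · rintro ⟨x, rfl⟩
    obtain ⟨s, hs, h1⟩ | ⟨b, e, he, hb, rfl⟩ := hS.doubleLabel_cases x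
    · exact .inr ⟨s, s.2, hs.symm⟩
    · exact .inl ⟨(b, G.faceOf e), ⟨trivial, he⟩, hb.symm⟩
  · rintro (⟨⟨b, f⟩, ⟨-, hf⟩, rfl⟩ | ⟨s, hs, rfl⟩)
    · obtain ⟨e, rfl⟩ := exists_faceOf f
      cases b
      · exact ⟨(false, .inl e), copyLabel_of_inner hf _⟩
      · exact ⟨(true, .inl e.symm), by
          rw [doubleLabel, SimpleGraph.Dart.symm_symm, copyLabel_of_inner hf]⟩
    · exact ⟨(true, .inr ⟨s, hs⟩), hS.copyLabel_of_mem hs _⟩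

/-- Both outer faces disappear and each spoke accounts for one new face; the 2 stands on the left to
avoid subtraction. -/
theorem ncard_range_doubleLabel :
    (Set.range (doubleLabel S)).ncard + 2 = 2 * Nat.card G.Face + S.ncard := by
  rw [hS.range_doubleLabel, Set.ncard_union_eq
    (Set.disjoint_left.2 (by rintro _ ⟨a, -, rfl⟩ ⟨b, -, hb⟩; cases hb)),
    Set.ncard_image_of_injective _ Sum.inl_injective,
    Set.ncard_image_of_injective _ Sum.inr_injective, Set.ncard_prod, Set.ncard_univ]
  have := Set.ncard_compl_add_ncard {G.outer}
  rw [Set.ncard_singleton] at this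
  simp only [Nat.card_eq_fintype_card, Fintype.card_bool]
  have h : Nat.card G.Face = Nat.card G.rotation.Face := rfl
  omega

end IsSpokeSet

/-! ### The double as a plane graph -/

/-- The darts of the double. -/
def doubleDart : Bool × (G.graph.Dart ⊕ S) → (G.doubleGraph S).Dart
  | (b, .inl e) => ⟨((b, e.fst), (b, e.snd)), .inl ⟨rfl, e.adj⟩⟩
  | (b, .inr s) => ⟨((b, s.1.fst), (!b, s.1.fst)), .inr ⟨by simp, rfl, s.1, s.2, rfl⟩⟩

theorem doubleDart_symm (x : Bool × (G.graph.Dart ⊕ S)) :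
    (doubleDart x).symm = doubleDart (doubleSymm x) := by
  rcases x with ⟨b, e | s⟩
  · rfl
  · cases b <;> rfl

/-- The starting vertex of a dart or spoke. -/
def spokeBase : G.graph.Dart ⊕ S → V := Sum.elim (fun e => e.fst) (fun s => s.1.fst)

theorem doubleDart_fst (x : Bool × (G.graph.Dart ⊕ S)) :
    (doubleDart x).fst = (x.1, spokeBase x.2) := by
  rcases x with ⟨b, e | s⟩ <;> rfl

theorem spokeBase_spokeRot (y : G.graph.Dart ⊕ S) : spokeBase (G.spokeRot S y) = spokeBase y := by
  rcases y with e | s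
  · rw [spokeRot_inl]
    by_cases h : G.rotation.rot e ∈ S
    · rw [spokeSwap_inl_of_mem h]
      exact G.rotation.rot_fst e
    · rw [spokeSwap_inl_of_notMem h]
      exact G.rotation.rot_fst e
  · rfl

theorem spokeBase_doubleRot (x : Bool × (G.graph.Dart ⊕ S)) :
    (G.doubleRot S x).1 = x.1 ∧ spokeBase (G.doubleRot S x).2 = spokeBase x.2 := by
  rcases x with ⟨_ | _, y⟩
  · exact ⟨rfl, spokeBase_spokeRot y⟩
  · refine ⟨rfl, ?_⟩
    change spokeBase ((G.spokeRot S)⁻¹ y) = spokeBase y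
    rw [← spokeBase_spokeRot, perm_apply_inv_self]

theorem spokeRot_sameCycle_inl {d e : G.graph.Dart} (h : d.fst = e.fst) :
    (G.spokeRot S).SameCycle (.inl d) (.inl e) := by
  refine (iff_of_sameCycle (p := fun e => (G.spokeRot S).SameCycle (.inl d) (.inl e))
    (G.rotation.rot_cyclic d e h) fun z _ => ?_).1 (.refl _ _)
  by_cases hz : G.rotation.rot z ∈ S
  · have : G.spokeRot S (G.spokeRot S (.inl z)) = .inl (G.rotation.rot z) := by
      rw [spokeRot_inl, spokeSwap_inl_of_mem hz, spokeRot_inr]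
    rw [← this, Equiv.Perm.sameCycle_apply_right, Equiv.Perm.sameCycle_apply_right]
  · rw [← spokeSwap_inl_of_notMem hz, ← spokeRot_inl, Equiv.Perm.sameCycle_apply_right]

theorem spokeRot_sameCycle {x y : G.graph.Dart ⊕ S} (h : spokeBase x = spokeBase y) :
    (G.spokeRot S).SameCycle x y := by
  have key : ∀ x : G.graph.Dart ⊕ S, ∃ d : G.graph.Dart, d.fst = spokeBase x ∧
      (G.spokeRot S).SameCycle x (.inl d) := by
    rintro (e | s)
    · exact ⟨e, rfl, .refl _ _⟩
    · refine ⟨s.1, rfl, ?_⟩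
      rw [← Equiv.Perm.sameCycle_apply_left, spokeRot_inr]
  obtain ⟨d, hd, hxd⟩ := key x
  obtain ⟨e, he, hye⟩ := key y
  exact hxd.trans ((spokeRot_sameCycle_inl (hd.trans (h.trans he.symm))).trans hye.symm)

namespace IsSpokeSet

variable (hS : G.IsSpokeSet S)
include hS

/-- Injectivity on spokes rests on the distinct starting vertices of `S`: a simple graph has room
for only one spoke at a vertex. -/
theorem doubleDart_bijective : Function.Bijective (doubleDart (S := S)) := by
  constructor
  · rintro ⟨b, e | s⟩ ⟨c, e' | t⟩ h
    all_goals
      have h1 := congrArg (fun d => d.fst) h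
      have h2 := congrArg (fun d => d.snd) h
      simp only [doubleDart, Prod.mk.injEq] at h1 h2
    · rw [h1.1, SimpleGraph.Dart.ext e e' (Prod.ext h1.2 h2.2)]
    · simpa using h1.1.symm.trans h2.1
    · simpa using h1.1.trans h2.1.symm
    · rw [h1.1, Subtype.ext (hS.injOn s.2 t.2 h1.2)]
  · rintro ⟨⟨⟨b, v⟩, ⟨c, w⟩⟩, h⟩
    obtain ⟨h1, h2⟩ | ⟨h1, h2, s, hs, h3⟩ := id h
    · obtain rfl : b = c := h1
      exact ⟨(b, .inl ⟨(v, w), h2⟩), rfl⟩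
    · obtain rfl : v = w := h2
      obtain rfl : s.fst = v := h3
      obtain rfl : c = !b := by cases b <;> cases c <;> simp at h1 ⊢
      exact ⟨(b, .inr ⟨s, hs⟩), rfl⟩

/-- Darts of the double correspond to darts of the copies and spokes. -/
noncomputable def dartEquiv : Bool × (G.graph.Dart ⊕ S) ≃ (G.doubleGraph S).Dart :=
  Equiv.ofBijective doubleDart hS.doubleDart_bijective

theorem dartEquiv_apply (x : Bool × (G.graph.Dart ⊕ S)) : hS.dartEquiv x = doubleDart x := rfl

/-- The embedding of the double. -/
noncomputable def doubleRotation : RotationSystem (G.doubleGraph S) where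
  rot := hS.dartEquiv.permCongr (G.doubleRot S)
  rot_fst d := by
    obtain ⟨x, rfl⟩ := hS.dartEquiv.surjective d
    rw [Equiv.permCongr_apply, Equiv.symm_apply_apply, dartEquiv_apply, dartEquiv_apply,
      doubleDart_fst, doubleDart_fst, (spokeBase_doubleRot x).1, (spokeBase_doubleRot x).2]
  rot_cyclic d e h := by
    obtain ⟨x, rfl⟩ := hS.dartEquiv.surjective d
    obtain ⟨y, rfl⟩ := hS.dartEquiv.surjective e
    rw [sameCycle_iff_of_semiconj (f := G.doubleRot S) hS.dartEquiv fun z => by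
      rw [Equiv.permCongr_apply, Equiv.symm_apply_apply]]
    rw [dartEquiv_apply, dartEquiv_apply, doubleDart_fst, doubleDart_fst, Prod.mk.injEq] at h
    rcases x with ⟨b, x⟩
    rcases y with ⟨c, y⟩
    obtain ⟨rfl, h⟩ := h
    cases b
    · exact sameCycle_of_semiconj (e := Prod.mk false) (fun _ => rfl) (spokeRot_sameCycle h)
    · exact sameCycle_of_semiconj (e := Prod.mk true) (fun _ => rfl)
        (Equiv.Perm.sameCycle_inv.2 (spokeRot_sameCycle h))

theorem doubleRotation_rot (x : Bool × (G.graph.Dart ⊕ S)) :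
    hS.doubleRotation.rot (doubleDart x) = doubleDart (G.doubleRot S x) := by
  rw [← hS.dartEquiv_apply, doubleRotation, Equiv.permCongr_apply, Equiv.symm_apply_apply,
    dartEquiv_apply]

theorem doubleRotation_faceNext (x : Bool × (G.graph.Dart ⊕ S)) :
    hS.doubleRotation.faceNext (hS.dartEquiv x) = hS.dartEquiv (G.doubleNext S x) := by
  change hS.doubleRotation.rot (doubleDart x).symm = _
  rw [doubleDart_symm, doubleRotation_rot]
  rfl

theorem faceNext_sameCycle_iff {x y : Bool × (G.graph.Dart ⊕ S)} :
    hS.doubleRotation.faceNext.SameCycle (doubleDart x) (doubleDart y) ↔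
      doubleLabel S x = doubleLabel S y := by
  rw [← hS.dartEquiv_apply, ← hS.dartEquiv_apply,
    sameCycle_iff_of_semiconj hS.dartEquiv hS.doubleRotation_faceNext, hS.doubleNext_sameCycle_iff]

theorem card_face_double : Nat.card hS.doubleRotation.Face + 2 = 2 * Nat.card G.Face + S.ncard := by
  have h : Equiv.Perm.SameCycle.setoid hS.doubleRotation.faceNext =
      Setoid.ker (doubleLabel S ∘ hS.dartEquiv.symm) := by
    ext a b
    obtain ⟨x, rfl⟩ := hS.dartEquiv.surjective a
    obtain ⟨y, rfl⟩ := hS.dartEquiv.surjective b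
    rw [Setoid.ker_def]
    simp only [Function.comp_apply, Equiv.symm_apply_apply]
    exact hS.faceNext_sameCycle_iff
  rw [← hS.ncard_range_doubleLabel, RotationSystem.Face, h,
    Nat.card_congr (Setoid.quotientKerEquivRange _), Nat.card_coe_set_eq,
    hS.dartEquiv.symm.surjective.range_comp]

end IsSpokeSet

theorem card_dart {W : Type*} [Finite W] (K : SimpleGraph W) :
    Nat.card K.Dart = 2 * K.edgeSet.ncard := by
  classical
  have := Fintype.ofFinite W
  rw [Nat.card_eq_fintype_card, K.dart_card_eq_twice_card_edges,
    Set.ncard_eq_toFinset_card' K.edgeSet]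
  rfl

namespace IsSpokeSet

variable (hS : G.IsSpokeSet S)
include hS

theorem doubleGraph_connected : (G.doubleGraph S).Connected := by
  obtain ⟨s, hs⟩ := hS.nonempty
  have hcopy : ∀ b v w, (G.doubleGraph S).Reachable (b, v) (b, w) := fun b v w =>
    (G.connected v w).map (⟨Prod.mk b, fun h => .inl ⟨rfl, h⟩⟩ : G.graph →g G.doubleGraph S)
  have hs' : ∀ b c, (G.doubleGraph S).Reachable (b, s.fst) (c, s.fst) := by
    intro b c
    by_cases h : b = c
    · rw [h]
    · exact SimpleGraph.Adj.reachable (.inr ⟨h, rfl, s, hs, rfl⟩)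
  have : Nonempty (Bool × V) := ⟨(true, s.fst)⟩
  exact ⟨fun ⟨b, v⟩ ⟨c, w⟩ => (hcopy b v s.fst).trans ((hs' b c).trans (hcopy c s.fst w))⟩

/-- The double of a plane graph: the plane graph and its mirror image in the outer face, joined by
spokes at the starting vertices of the darts in `S`. -/
noncomputable def double : PlaneGraph (Bool × V) where
  finite := have := G.finite; inferInstance
  graph := G.doubleGraph S
  connected := hS.doubleGraph_connected
  rotation := hS.doubleRotation
  euler := by
    have := G.finite
    have h1 := hS.card_face_double
    have h2 := card_dart (G.doubleGraph S)
    rw [← Nat.card_congr hS.dartEquiv, Nat.card_prod, Nat.card_sum, card_dart, Nat.card_coe_set_eq]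
      at h2
    have h3 := G.euler
    have h4 : Nat.card G.Face = Nat.card G.rotation.Face := rfl
    rw [Nat.card_prod]
    have h5 : Nat.card Bool = 2 := by simp
    rw [h5] at h2 ⊢
    omega
  -- A face between spokes is not a copy of an inner face, so with this choice the copied inner
  -- faces stay inner.
  outer := Quotient.mk _ (doubleDart (true, .inr ⟨_, hS.nonempty.some_mem⟩))

/-- The darts of the double, as darts of a plane graph. -/
def dart (x : Bool × (G.graph.Dart ⊕ S)) : hS.double.graph.Dart := doubleDart x

theorem dart_symm (x : Bool × (G.graph.Dart ⊕ S)) : (hS.dart x).symm = hS.dart (doubleSymm x) :=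
  doubleDart_symm x

theorem dart_injective : Function.Injective hS.dart := hS.doubleDart_bijective.1

theorem exists_dart (d : hS.double.graph.Dart) : ∃ x, hS.dart x = d :=
  hS.doubleDart_bijective.2 d

theorem double_rot (x : Bool × (G.graph.Dart ⊕ S)) :
    hS.double.rotation.rot (hS.dart x) = hS.dart (G.doubleRot S x) :=
  hS.doubleRotation_rot x

theorem double_faceOf_eq_iff {x y : Bool × (G.graph.Dart ⊕ S)} :
    hS.double.faceOf (hS.dart x) = hS.double.faceOf (hS.dart y) ↔
      doubleLabel S x = doubleLabel S y :=
  faceOf_eq_iff.trans hS.faceNext_sameCycle_iff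

end IsSpokeSet

end PlaneGraph

/-! ### Removing a face bounded by a cycle -/

namespace PlaneGraph

variable {V : Type u} {G : PlaneGraph V}

/-- A property that changes along a cycle at most when entering and leaving one element does not
change when this element is skipped. -/
theorem iff_of_eq_off_turn {α : Type*} [Finite α] {σ : Equiv.Perm α} {p : α → Prop} {u : α}
    (h : ∀ x, σ.SameCycle u x → x ≠ u → x ≠ σ u → (p x ↔ p (σ x))) : p u ↔ p (σ (σ u)) := by
  classical
  have := Fintype.ofFinite α
  by_cases hu : u = σ u
  · rw [← hu, ← hu]
  let a : α → ℤ := fun x => if σ.SameCycle u x ∧ p x then 1 else 0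
  -- The differences sum to zero because `σ` is a permutation. Only those at `u` and `σ u` can be
  -- nonzero, and together they give `a u - a (σ (σ u))`.
  have hsum : ∑ x, (a x - a (σ x)) = 0 := by
    rw [Finset.sum_sub_distrib, Equiv.sum_comp σ a, sub_self]
  rw [← Finset.sum_subset (Finset.subset_univ {u, σ u}), Finset.sum_pair hu] at hsum
  · have h1 : a u = a (σ (σ u)) := by omega
    simp only [a, Equiv.Perm.sameCycle_apply_right, Equiv.Perm.SameCycle.rfl, true_and] at h1
    by_cases q : p u <;> by_cases r : p (σ (σ u)) <;> simp_all
  · intro x _ hx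
    simp only [Finset.mem_insert, Finset.mem_singleton, not_or] at hx
    simp only [a, Equiv.Perm.sameCycle_apply_right]
    by_cases hs : σ.SameCycle u x
    · simp only [h x hs hx.1 hx.2, sub_self]
    · simp [hs]

theorem fst_eq_of_sameCycle {d e : G.graph.Dart} (h : G.rotation.rot.SameCycle d e) :
    d.fst = e.fst :=
  (iff_of_sameCycle (p := fun x : G.graph.Dart => d.fst = x.fst) h fun z _ => by
    rw [G.rotation.rot_fst]).1 rfl

theorem BoundaryIsCycle.injOn {f : G.Face} (h : G.BoundaryIsCycle f) :
    Set.InjOn (fun d : G.graph.Dart => d.fst) (G.boundary f) := by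
  obtain ⟨v, c, hc, hf⟩ := h
  have hnd : (c.darts.map fun d => d.fst).Nodup := by
    rw [SimpleGraph.Walk.map_fst_darts]
    exact hc.nodup_dropLast_support
  intro d hd e he hde
  rw [← hf] at hd he
  exact List.inj_on_of_nodup_map hnd hd he hde

/-- Otherwise `d.symm` and the dart after `d` are boundary darts of `f` leaving the same vertex,
hence equal. The rotation then fixes `d.symm`, and `d.snd` has degree one. -/
theorem faceOf_symm_ne_of_injOn (hdeg : ∀ v, 2 ≤ G.deg v) {f : G.Face}
    (hinj : Set.InjOn (fun d : G.graph.Dart => d.fst) (G.boundary f)) {d : G.graph.Dart}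
    (hd : G.faceOf d = f) : G.faceOf d.symm ≠ f := by
  intro hd'
  have h1 : G.rotation.rot d.symm = d.symm :=
    hinj ((faceOf_faceNext d).trans hd) hd' (G.rotation.rot_fst _)
  obtain ⟨e, he, he'⟩ := exists_dart_ne (hdeg d.snd) d.fst
  have h2 := (G.rotation.rot_cyclic d.symm e he.symm).eq_of_left h1
  rw [← h2] at he'
  exact he' rfl

/-- A face whose boundary has no repeated vertices does not separate the other faces. -/
theorem faceConnected_compl_of_injOn (hdeg : ∀ v, 2 ≤ G.deg v) {f : G.Face}
    (hinj : Set.InjOn (fun d : G.graph.Dart => d.fst) (G.boundary f)) : G.FaceConnected {f}ᶜ := by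
  classical
  intro a ha b hb
  let p : G.Face → Prop := fun g => Relation.ReflTransGen
    (fun x y => x ∈ ({f}ᶜ : Set G.Face) ∧ y ∈ ({f}ᶜ : Set G.Face) ∧ G.FaceAdj x y) a g
  have hp : ∀ d, G.faceOf d ≠ f → G.faceOf d.symm ≠ f →
      (p (G.faceOf d) ↔ p (G.faceOf d.symm)) := fun d hd hd' =>
    ⟨fun h => h.tail ⟨hd, hd', d, rfl, rfl⟩, fun h => h.tail ⟨hd', hd, d.symm, rfl, by simp⟩⟩
  -- Among the darts at `d.snd` only the next boundary dart lies on `f`. Going round the vertex the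
  -- other way links the faces across the two boundary edges without meeting `f`.
  have hturn : ∀ d, G.faceOf d = f →
      (p (G.faceOf d.symm) ↔ p (G.faceOf (G.rotation.faceNext d).symm)) := by
    intro d hd
    rw [← faceOf_rot (G.rotation.faceNext d)]
    refine iff_of_eq_off_turn (σ := G.rotation.rot) (p := fun x => p (G.faceOf x))
      fun x hx h1 h2 => ?_
    have hxfst : x.fst = d.snd := (fst_eq_of_sameCycle hx).symm
    have hout : ∀ y : G.graph.Dart, y.fst = d.snd → G.faceOf y = f → y = G.rotation.faceNext d :=
      fun y hy hyf => hinj hyf ((faceOf_faceNext d).trans hd) (hy.trans (faceNext_fst d).symm)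
    rw [faceOf_rot]
    refine hp x (fun hxf => h2 (hout x hxfst hxf)) fun hxf => h1 ?_
    exact G.rotation.rot.injective
      (hout _ ((G.rotation.rot_fst x).trans hxfst) ((faceOf_rot x).trans hxf))
  obtain ⟨d₀, hd₀⟩ := exists_faceOf f
  have hconst : ∀ d, G.faceOf d = f → (p (G.faceOf d₀.symm) ↔ p (G.faceOf d.symm)) := by
    intro d hd
    refine iff_of_sameCycle (p := fun d : G.graph.Dart => p (G.faceOf d.symm))
      (faceOf_eq_iff.1 (hd₀.trans hd.symm)) fun z hz => ?_
    exact hturn z ((faceOf_eq_iff.2 hz).symm.trans hd₀)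
  -- Giving `f` the common value of the faces across its boundary makes the property invariant under
  -- all adjacencies, hence constant.
  have := face_iff_of_invariant (G := G)
    (p := fun g => if g = f then p (G.faceOf d₀.symm) else p g) (fun d => ?_) a b
  · rw [if_neg (show a ≠ f from ha), if_neg (show b ≠ f from hb)] at this
    exact this.1 .refl
  · by_cases hd : G.faceOf d = f
    · have hd' := faceOf_symm_ne_of_injOn hdeg hinj hd
      simp only [if_pos hd, if_neg hd']
      exact hconst d hd
    · by_cases hd' : G.faceOf d.symm = f
      · simp only [if_neg hd, if_pos hd']
        simpa using (hconst d.symm hd').symm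
      · simp only [if_neg hd, if_neg hd']
        exact hp d hd hd'

theorem FaceAdj.symm {a b : G.Face} (h : G.FaceAdj a b) : G.FaceAdj b a := by
  obtain ⟨d, rfl, rfl⟩ := h
  exact ⟨d.symm, rfl, by simp⟩

theorem doubleLabel_eq_inl {S : Set G.graph.Dart} {x : Bool × (G.graph.Dart ⊕ S)} {b : Bool}
    {f : G.Face} (hS : G.IsSpokeSet S) (h : doubleLabel S x = .inl (b, f)) :
    ∃ e, G.faceOf e = f ∧ f ≠ G.outer ∧ x = (b, .inl (cond b e.symm e)) := by
  obtain ⟨s, hs, -⟩ | ⟨c, e, he, hc, rfl⟩ := hS.doubleLabel_cases x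
  · rw [hs] at h
    cases h
  · rw [hc, Sum.inl.injEq, Prod.mk.injEq] at h
    obtain ⟨rfl, rfl⟩ := h
    exact ⟨e, rfl, he, rfl⟩

theorem doubleLabel_copy {S : Set G.graph.Dart} (b : Bool) (e : G.graph.Dart) :
    doubleLabel S (b, .inl (cond b e.symm e)) = copyLabel S b e := by
  cases b <;> simp [doubleLabel]

/-! ### The patch of copied inner faces -/

namespace IsSpokeSet

variable {S : Set G.graph.Dart} (hS : G.IsSpokeSet S)

/-- The copies of a face of `G` in the double. -/
noncomputable def copyFace (b : Bool) (f : G.Face) : hS.double.Face :=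
  hS.double.faceOf (hS.dart (b, .inl (cond b (exists_faceOf f).choose.symm
    (exists_faceOf f).choose)))

include hS

theorem faceOf_eq_copyFace_iff {x : Bool × (G.graph.Dart ⊕ S)} {b : Bool} {f : G.Face}
    (hf : f ≠ G.outer) :
    hS.double.faceOf (hS.dart x) = hS.copyFace b f ↔ doubleLabel S x = .inl (b, f) := by
  rw [copyFace, hS.double_faceOf_eq_iff, doubleLabel_copy, copyLabel_of_inner,
    (exists_faceOf f).choose_spec]
  rwa [(exists_faceOf f).choose_spec]

theorem faceOf_copy {e : G.graph.Dart} (he : G.faceOf e ≠ G.outer) (b : Bool) :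
    hS.double.faceOf (hS.dart (b, .inl (cond b e.symm e))) = hS.copyFace b (G.faceOf e) := by
  rw [hS.faceOf_eq_copyFace_iff he, doubleLabel_copy, copyLabel_of_inner he]

theorem face_cases (f : hS.double.Face) :
    (∃ s : S, f = hS.double.faceOf (hS.dart (true, .inl s.1.symm))) ∨
      ∃ b, ∃ g ≠ G.outer, f = hS.copyFace b g := by
  obtain ⟨d, rfl⟩ := exists_faceOf f
  obtain ⟨x, rfl⟩ := hS.exists_dart d
  obtain ⟨s, hs, -⟩ | ⟨b, e, he, hb, -⟩ := hS.doubleLabel_cases x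
  · refine .inl ⟨s, ?_⟩
    rw [hS.double_faceOf_eq_iff, hs, doubleLabel, SimpleGraph.Dart.symm_symm,
      hS.copyLabel_of_mem s.2]
  · exact .inr ⟨b, _, he, (hS.faceOf_eq_copyFace_iff he).2 hb⟩

theorem copyFace_ne {f g : G.Face} (hf : f ≠ G.outer) (hg : g ≠ G.outer) :
    hS.copyFace true f ≠ hS.copyFace false g := by
  intro h
  obtain ⟨e, rfl⟩ := exists_faceOf f
  rw [← hS.faceOf_copy hf, hS.faceOf_eq_copyFace_iff hg, doubleLabel_copy,
    copyLabel_of_inner hf] at h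
  simp at h

theorem reflTransGen_copyFace (hconn : G.FaceConnected {G.outer}ᶜ) {Q : Set hS.double.Face}
    {b : Bool} (hQ : ∀ f, f ≠ G.outer → hS.copyFace b f ∈ Q) {f g : G.Face}
    (hf : f ≠ G.outer) (hg : g ≠ G.outer) :
    Relation.ReflTransGen (fun x y => x ∈ Q ∧ y ∈ Q ∧ hS.double.FaceAdj x y)
      (hS.copyFace b f) (hS.copyFace b g) := by
  refine (hconn f hf g hg).lift (hS.copyFace b) ?_
  rintro x y ⟨hx, hy, d, rfl, rfl⟩
  refine ⟨hQ _ hx, hQ _ hy, hS.dart (b, .inl (cond b d.symm d)), hS.faceOf_copy hx b, ?_⟩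
  rw [← hS.faceOf_copy hy b, hS.dart_symm]
  cases b <;> rfl

/-- In the complement, each face between spokes is adjacent to a mirrored inner face across the
mirrored edge of a dart in `S`, and the mirrored inner faces are connected among themselves. -/
theorem isPatch (hconn : G.FaceConnected {G.outer}ᶜ)
    (hsymm : ∀ s ∈ S, G.faceOf s.symm ≠ G.outer) :
    hS.double.IsPatch (hS.copyFace false '' {G.outer}ᶜ) := by
  obtain ⟨s₀, hs₀⟩ := hS.nonempty
  refine ⟨fun h => ?_, ?_, ?_⟩
  · obtain ⟨g, hg, hgs⟩ : hS.copyFace true (G.faceOf s₀.symm) ∈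
        hS.copyFace false '' {G.outer}ᶜ := by
      rw [h]
      trivial
    exact hS.copyFace_ne (hsymm _ hs₀) hg hgs.symm
  · rintro _ ⟨f, hf, rfl⟩ _ ⟨g, hg, rfl⟩
    exact hS.reflTransGen_copyFace hconn (fun _ hx => Set.mem_image_of_mem _ hx) hf hg
  · set Q : Set hS.double.Face := (hS.copyFace false '' {G.outer}ᶜ)ᶜ with hQdef
    have hQ : ∀ f, f ≠ G.outer → hS.copyFace true f ∈ Q := by
      rintro f hf ⟨g, hg, hgf⟩
      exact hS.copyFace_ne hf hg hgf.symm
    have key : ∀ a ∈ Q, ∃ f, f ≠ G.outer ∧ Relation.ReflTransGen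
        (fun x y => x ∈ Q ∧ y ∈ Q ∧ hS.double.FaceAdj x y) a (hS.copyFace true f) := by
      intro a ha
      obtain ⟨s, rfl⟩ | ⟨b, g, hg, rfl⟩ := hS.face_cases a
      · refine ⟨G.faceOf s.1.symm, hsymm _ s.2, .single ⟨ha, hQ _ (hsymm _ s.2), _, rfl, ?_⟩⟩
        rw [← hS.faceOf_copy (hsymm _ s.2) true, hS.dart_symm]
        rfl
      · cases b
        · exact absurd ⟨g, hg, rfl⟩ ha
        · exact ⟨g, hg, .refl⟩
    intro a ha b hb
    obtain ⟨f, hf, haf⟩ := key a ha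
    obtain ⟨g, hg, hbg⟩ := key b hb
    have hsym : Std.Symm fun x y => x ∈ Q ∧ y ∈ Q ∧ hS.double.FaceAdj x y :=
      ⟨fun x y h => ⟨h.2.1, h.1, h.2.2.symm⟩⟩
    exact haf.trans ((hS.reflTransGen_copyFace hconn hQ hf hg).trans (symm hbg))

/-- The first copy of `G` in the double. -/
def copy : SimpleGraph.Copy G.graph hS.double.graph :=
  ⟨⟨Prod.mk false, fun h => .inl ⟨rfl, h⟩⟩, fun _ _ h => (Prod.mk.inj h).2⟩

theorem mapDart_copy (e : G.graph.Dart) :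
    hS.copy.toHom.mapDart e = hS.dart (false, .inl e) := rfl

theorem respectsRotation : RespectsRotation hS.copy := by
  intro d
  by_cases h : G.rotation.rot d ∈ S
  · have h1 : G.doubleRot S (false, .inl d) = (false, .inr ⟨_, h⟩) :=
      congrArg (Prod.mk false) (spokeSwap_inl_of_mem h)
    -- Two turns are needed where the spoke is inserted before the next dart.
    refine ⟨2, two_pos, ?_, fun j hj hj' => ?_⟩
    · rw [mapDart_copy, pow_two, Equiv.Perm.mul_apply, hS.double_rot, h1, hS.double_rot]
      rfl
    · obtain rfl : j = 1 := by omega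
      rw [mapDart_copy, pow_one, hS.double_rot, h1]
      rintro ⟨e, he⟩
      have he' : hS.dart (false, .inl e) = hS.dart (false, .inr ⟨_, h⟩) := he
      simpa using hS.dart_injective he'
  · have h1 : G.doubleRot S (false, .inl d) = (false, .inl (G.rotation.rot d)) :=
      congrArg (Prod.mk false) (spokeSwap_inl_of_notMem h)
    refine ⟨1, one_pos, ?_, fun j hj hj' => by omega⟩
    rw [mapDart_copy, pow_one, hS.double_rot, h1]
    rfl

theorem preservesInnerFaces : PreservesInnerFaces hS.copy := by
  intro f hf
  refine ⟨hS.copyFace false f, fun h => ?_, ?_⟩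
  · have := (hS.faceOf_eq_copyFace_iff hf).1 h.symm
    rw [doubleLabel, hS.copyLabel_of_mem hS.nonempty.some_mem] at this
    cases this
  · ext d
    constructor
    · rintro ⟨e, rfl, rfl⟩
      exact hS.faceOf_copy hf false
    · intro hd
      obtain ⟨x, rfl⟩ := hS.exists_dart d
      obtain ⟨e, rfl, -, rfl⟩ := doubleLabel_eq_inl hS ((hS.faceOf_eq_copyFace_iff hf).1 hd)
      exact ⟨e, rfl, rfl⟩

theorem mem_copyFace_image {x : Bool × (G.graph.Dart ⊕ S)}
    (h : hS.double.faceOf (hS.dart x) ∈ hS.copyFace false '' {G.outer}ᶜ) :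
    ∃ e, G.faceOf e ≠ G.outer ∧ x = (false, .inl e) := by
  obtain ⟨f, hf, hfx⟩ := h
  obtain ⟨e, rfl, -, rfl⟩ := doubleLabel_eq_inl hS ((hS.faceOf_eq_copyFace_iff hf).1 hfx.symm)
  exact ⟨e, hf, rfl⟩

/-- No edge has the outer face on both sides, so every edge and vertex of the first copy borders a
copied inner face; these faces in turn have all their darts in that copy. -/
theorem skeleton_eq (hdart : ∀ v, ∃ d : G.graph.Dart, d.fst = v)
    (hsymm : ∀ d, G.faceOf d = G.outer → G.faceOf d.symm ≠ G.outer) :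
    hS.double.skeleton (hS.copyFace false '' {G.outer}ᶜ) = hS.copy.toSubgraph := by
  ext x y
  · constructor
    · rintro ⟨_, hf, d, rfl, rfl⟩
      obtain ⟨x, rfl⟩ := hS.exists_dart d
      obtain ⟨e, -, rfl⟩ := hS.mem_copyFace_image hf
      exact ⟨e.fst, trivial, rfl⟩
    · rintro ⟨v, -, rfl⟩
      obtain ⟨d, rfl, hd⟩ : ∃ d : G.graph.Dart, d.fst = v ∧ G.faceOf d ≠ G.outer := by
        obtain ⟨d, rfl⟩ := hdart v
        by_cases hd : G.faceOf d = G.outer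
        · exact ⟨G.rotation.rot d, G.rotation.rot_fst d, by rw [faceOf_rot]; exact hsymm d hd⟩
        · exact ⟨d, rfl, hd⟩
      exact ⟨_, ⟨_, hd, rfl⟩, hS.dart (false, .inl d), hS.faceOf_copy hd false, rfl⟩
  · constructor
    · rintro ⟨d, rfl, rfl, h⟩
      obtain ⟨x, rfl⟩ := hS.exists_dart d
      rw [hS.dart_symm] at h
      obtain h | h := h
      · obtain ⟨e, -, rfl⟩ := hS.mem_copyFace_image h
        exact ⟨_, _, e.adj, rfl, rfl⟩
      · obtain ⟨e, -, he⟩ := hS.mem_copyFace_image h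
        obtain rfl : x = (false, .inl e.symm) := by
          rw [← doubleSymm_involutive x, he]
          rfl
        exact ⟨_, _, e.symm.adj, rfl, rfl⟩
    · rintro ⟨v, w, h, rfl, rfl⟩
      refine ⟨hS.dart (false, .inl ⟨(v, w), h⟩), rfl, rfl, ?_⟩
      by_cases hd : G.faceOf ⟨(v, w), h⟩ = G.outer
      · exact .inr ⟨_, hsymm _ hd, (hS.faceOf_copy (hsymm _ hd) false).symm⟩
      · exact .inl ⟨_, hd, (hS.faceOf_copy hd false).symm⟩

/-! ### Degrees, bipartiteness and 2-connectedness -/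

theorem deg_double_of_notMem {v : V} (hv : ∀ s ∈ S, s.fst ≠ v) (b : Bool) :
    hS.double.deg (b, v) = G.deg v := by
  have : hS.double.graph.neighborSet (b, v) = Prod.mk b '' G.graph.neighborSet v := by
    ext ⟨c, w⟩
    constructor
    · rintro (⟨h, h'⟩ | ⟨-, h, s, hs, h'⟩)
      · obtain rfl : b = c := h
        exact ⟨w, h', rfl⟩
      · obtain rfl : v = w := h
        exact absurd h' (hv s hs)
    · rintro ⟨w, h, h'⟩
      cases h'
      exact .inl ⟨rfl, h⟩
  rw [deg, this, Set.ncard_image_of_injective _ (Prod.mk_right_injective b), deg]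

theorem deg_double_of_mem {s : G.graph.Dart} (hs : s ∈ S) (b : Bool) :
    hS.double.deg (b, s.fst) = G.deg s.fst + 1 := by
  have := G.finite
  have h : hS.double.graph.neighborSet (b, s.fst) =
      insert (!b, s.fst) (Prod.mk b '' G.graph.neighborSet s.fst) := by
    ext ⟨c, w⟩
    constructor
    · rintro (⟨h, h'⟩ | ⟨h, h', -⟩)
      · obtain rfl : b = c := h
        exact .inr ⟨w, h', rfl⟩
      · obtain rfl : s.fst = w := h'
        refine .inl (Prod.ext ?_ rfl)
        cases b <;> cases c <;> simp at h ⊢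
    · rintro (h | ⟨w, h, h'⟩)
      · cases h
        exact .inr ⟨by simp, rfl, s, hs, rfl⟩
      · cases h'
        exact .inl ⟨rfl, h⟩
  rw [deg, h, Set.ncard_insert_of_notMem (by simp),
    Set.ncard_image_of_injective _ (Prod.mk_right_injective b), deg]

theorem isBipartite_double (h : G.graph.IsBipartite) : hS.double.graph.IsBipartite := by
  obtain ⟨C⟩ := h
  -- Colours are swapped in the mirror image, since a spoke joins the two copies of one vertex.
  refine ⟨SimpleGraph.Coloring.mk (fun x => C x.2 + cond x.1 1 0) ?_⟩
  rintro ⟨b, v⟩ ⟨c, w⟩ (⟨h, h'⟩ | ⟨h, h', -⟩)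
  · obtain rfl : b = c := h
    exact fun he => C.valid h' (add_right_cancel he)
  · obtain rfl : v = w := h'
    intro he
    have := add_left_cancel he
    cases b <;> cases c <;> simp at h this

/-- Deleting a vertex leaves the other copy intact and the rest of its own copy connected; a spoke
away from the deleted vertex joins the two. -/
theorem twoConnected_double (h : G.TwoConnected) (htwo : ∀ v, ∃ s ∈ S, s.fst ≠ v) :
    hS.double.TwoConnected := by
  have := G.finite
  refine ⟨?_, hS.double.connected, ?_⟩
  · rw [Nat.card_prod, Nat.card_eq_fintype_card (α := Bool), Fintype.card_bool]
    have := h.1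
    omega
  · rintro ⟨b, v⟩
    obtain ⟨s, hs, hsv⟩ := htwo v
    have hne : ∀ w, (!b, w) ∈ ({(b, v)}ᶜ : Set (Bool × V)) := fun w hw => by
      cases b <;> simp at hw
    have hne' : ∀ w : ({v}ᶜ : Set V), (b, w.1) ∈ ({(b, v)}ᶜ : Set (Bool × V)) := fun w hw =>
      w.2 (Prod.mk.inj hw).2
    let K := hS.double.graph.induce {(b, v)}ᶜ
    have h1 : ∀ w w', K.Reachable ⟨(!b, w), hne w⟩ ⟨(!b, w'), hne w'⟩ := fun w w' =>
      (G.connected w w').map (⟨fun w => ⟨(!b, w), hne w⟩, fun h => .inl ⟨rfl, h⟩⟩ : G.graph →g K)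
    have h2 : ∀ w w', K.Reachable ⟨(b, w.1), hne' w⟩ ⟨(b, w'.1), hne' w'⟩ := fun w w' =>
      ((h.2.2 v) w w').map
        (⟨fun w => ⟨(b, w.1), hne' w⟩, fun h => .inl ⟨rfl, h⟩⟩ : G.graph.induce {v}ᶜ →g K)
    have h3 : K.Adj ⟨(b, s.fst), hne' ⟨s.fst, hsv⟩⟩ ⟨(!b, s.fst), hne _⟩ :=
      .inr ⟨by simp, rfl, s, hs, rfl⟩
    have h4 : ∀ x, K.Reachable x ⟨(!b, s.fst), hne _⟩ := by
      rintro ⟨⟨c, w⟩, hw⟩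
      by_cases hc : c = b
      · obtain rfl := hc
        exact (h2 ⟨w, fun h => hw (by rw [h]; rfl)⟩ ⟨s.fst, hsv⟩).trans h3.reachable
      · obtain rfl : c = !b := by cases b <;> cases c <;> simp at hc ⊢
        exact h1 _ _
    have : Nonempty ({(b, v)}ᶜ : Set (Bool × V)) := ⟨⟨(!b, s.fst), hne _⟩⟩
    exact ⟨fun x y => (h4 x).trans (h4 y).symm⟩

end IsSpokeSet

/-- A bipartite subcubic graph does not have exactly one vertex of degree two. -/
theorem exists_ne_deg_eq_two (hsub : G.IsSubcubic) (hbip : G.graph.IsBipartite) {v : V}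
    (hv : G.deg v = 2) : ∃ w, w ≠ v ∧ G.deg w = 2 := by
  classical
  have := G.finite
  have := Fintype.ofFinite V
  by_contra! hall
  have hdeg : ∀ w, G.graph.degree w = if w = v then 2 else 3 := by
    intro w
    have : G.graph.degree w = G.deg w := by
      rw [← SimpleGraph.card_neighborSet_eq_degree, deg, ← Nat.card_coe_set_eq,
        Nat.card_eq_fintype_card]
    rw [this]
    split_ifs with h
    · rw [h, hv]
    · exact (hsub w).resolve_left (hall w h)
  obtain ⟨C⟩ := hbip
  let A (i : Fin 2) : Finset V := Finset.univ.filter fun w => C w = i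
  have hA : G.graph.IsBipartiteWith (A 0 : Set V) (A 1) := by
    refine ⟨?_, fun u w huw => ?_⟩
    · rw [Finset.disjoint_coe, Finset.disjoint_left]
      intro w h0 h1
      simp only [A, Finset.mem_filter, Finset.mem_univ, true_and] at h0 h1
      rw [h0] at h1
      exact absurd h1 (by decide)
    · have := C.valid huw
      simp only [A, Finset.coe_filter, Finset.mem_univ, true_and, Set.mem_ofPred_eq]
      omega
  have hsum := SimpleGraph.isBipartiteWith_sum_degrees_eq hA
  -- The degree sum of a colour class is three times its size, less one for the class of `v`. The
  -- two sums agree, which is impossible modulo 3.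
  have hcount : ∀ i, ∑ w ∈ A i, G.graph.degree w + (if C v = i then 1 else 0) = 3 * (A i).card := by
    intro i
    have h1 : (if C v = i then 1 else 0) = ∑ w ∈ A i, if w = v then 1 else 0 := by
      rw [Finset.sum_ite_eq' (A i) v]
      simp [A]
    rw [h1, ← Finset.sum_add_distrib, Finset.sum_congr rfl (g := fun _ => 3), Finset.sum_const,
      smul_eq_mul, mul_comm]
    intro w _
    rw [hdeg]
    split_ifs <;> rfl
  have h0 := hcount 0
  have h1 := hcount 1
  rcases (by omega : C v = 0 ∨ C v = 1) with h | h <;> simp [h] at h0 h1 <;> omega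

end PlaneGraph

/-! ### The proposition -/

open PlaneGraph in
theorem mainTheorem12 {V : Type u} (G : PlaneGraph V)
    (hsub : G.IsSubcubic)
    (houter : ∀ v, G.deg v = 2 → G.IsOnFace v G.outer)
    (hperimeter : (∃ v, G.deg v = 2) → G.BoundaryIsCycle G.outer) :
    (∃ (W : Type u) (H : PlaneGraph W), G.IsCubicExtension H) ∧
    (G.TwoConnected → 2 ≤ {v | G.deg v = 2}.ncard →
      ∃ (W : Type u) (H : PlaneGraph W), G.IsCubicExtension H ∧ H.TwoConnected) ∧
    (G.graph.IsBipartite →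
      ∃ (W : Type u) (H : PlaneGraph W), G.IsCubicExtension H ∧ H.graph.IsBipartite) ∧
    (G.graph.IsBipartite → G.TwoConnected →
      ∃ (W : Type u) (H : PlaneGraph W),
        G.IsCubicExtension H ∧ H.graph.IsBipartite ∧ H.TwoConnected) := by
  have hdeg : ∀ v, 2 ≤ G.deg v := fun v => by
    have := hsub v
    omega
  by_cases hex : ∃ v, G.deg v = 2
  · have hinj := (hperimeter hex).injOn
    have hsymm : ∀ d, G.faceOf d = G.outer → G.faceOf d.symm ≠ G.outer := fun d =>
      faceOf_symm_ne_of_injOn hdeg hinj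
    -- One spoke per vertex of degree 2: such a vertex lies on the outer cycle, so exactly one outer
    -- dart starts there.
    have hS : G.IsSpokeSet {d | G.faceOf d = G.outer ∧ G.deg d.fst = 2} := by
      refine ⟨fun d hd => hd.1, hinj.mono fun d hd => hd.1, ?_⟩
      obtain ⟨v, hv⟩ := hex
      obtain ⟨d, hd, rfl⟩ := houter v hv
      exact ⟨d, hd, hv⟩
    have hext : G.IsCubicExtension hS.double := by
      refine ⟨?_, hS.copy, hS.respectsRotation, hS.preservesInnerFaces, _,
        hS.isPatch (faceConnected_compl_of_injOn hdeg hinj) fun s hs => hsymm s hs.1,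
        hS.skeleton_eq (fun v => ?_) hsymm⟩
      · rintro ⟨b, v⟩
        obtain hv | hv := hsub v
        · obtain ⟨d, hd, rfl⟩ := houter v hv
          rw [hS.deg_double_of_mem ⟨hd, hv⟩, hv]
        · rw [hS.deg_double_of_notMem _ b, hv]
          rintro s hs rfl
          have := hs.2
          omega
      · obtain ⟨d, hd, -⟩ := exists_dart_ne (hdeg v) v
        exact ⟨d, hd⟩
    have htwo : (∀ v, ∃ w, w ≠ v ∧ G.deg w = 2) →
        ∀ v, ∃ s ∈ {d | G.faceOf d = G.outer ∧ G.deg d.fst = 2}, s.fst ≠ v := by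
      intro h v
      obtain ⟨w, hw, hw'⟩ := h v
      obtain ⟨d, hd, rfl⟩ := houter w hw'
      exact ⟨d, ⟨hd, hw'⟩, hw⟩
    refine ⟨⟨_, _, hext⟩, fun h2 hn => ⟨_, _, hext, hS.twoConnected_double h2 (htwo fun v => ?_)⟩,
      fun hb => ⟨_, _, hext, hS.isBipartite_double hb⟩, fun hb h2 => ⟨_, _, hext,
      hS.isBipartite_double hb, hS.twoConnected_double h2 (htwo fun v => ?_)⟩⟩
    · obtain ⟨w, hw, hne⟩ := Set.exists_ne_of_one_lt_ncard hn v
      exact ⟨w, hne, hw⟩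
    · by_cases hv : G.deg v = 2
      · exact exists_ne_deg_eq_two hsub hb hv
      · obtain ⟨w, hw⟩ := hex
        exact ⟨w, fun h => hv (h ▸ hw), hw⟩
  · have hext := isCubicExtension_self (G := G) fun v =>
      (hsub v).resolve_left fun h => hex ⟨v, h⟩
    exact ⟨⟨_, _, hext⟩, fun h2 _ => ⟨_, _, hext, h2⟩, fun hb => ⟨_, _, hext, hb⟩,
      fun hb h2 => ⟨_, _, hext, hb, h2⟩⟩
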